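/- \textbf{Setting.} Let $n\ge 0$ be an integer and let $t_{min}>0$, $t_{max}, r_{max}, c, y_{i,min}, y_{i,max}\ge 0$ ($1\le i\le n$) be constants. On a probability space let $\{A[k]\}_{k\ge 1}$ be i.i.d. random matrices; $A[k]$ has a random finite positive number of rows, each of the form $(t,r,y)\in\mathbb R\times\mathbb R\times\mathbb R^n$, and all rows surely satisfy $t_{min}\le t\le t_{max}$, $0\le r\le r_{max}$, $\|y\|\le c$ and $-y_{i,min}\le y_i\le y_{i,max}$ for all $i$ ($\|\cdot\|$ is the Euclidean norm). The probability space also carries a random variable $U$, uniform on $[0,1]$ and independent of $\{A[k]\}_{k\ge1}$. Let $\Gamma\subseteq\mathbb R^{n+2}$ be the set of all expectations $\mathbb E[D]$ of random vectors $D$ that always take their value in the set of rows $Row(A[1])$ (replacing $A[1]$ by any other $A[k]$ gives the same set), and let $\overline\Gamma$ be its closure. The deterministic problem is $$\text{maximize } r/t \quad\text{subject to}\quad y_i\le 0\ \ (1\le i\le n),\quad (t,r,y)\in\overline\Gamma .$$ \textbf{Algorithm.} Fix $v>0$, $\alpha>0$, $q=(q_1,\dots,q_n)\ge 0$, and put $\gamma_{min}=1/t_{max}$,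 $\gamma_{max}=1/t_{min}$; let $[z]_a^b$ be the projection of $z$ onto $[a,b]$. Start with $Q_i[1]=0$, $J[1]=0$, $\gamma[0]=\gamma_{min}$. For each task $k=1,2,3,\dots$: \begin{itemize} \item choose $(T[k],R[k],Y[k])\in Row(A[k])$ to minimize $-vR[k]+J[k]T[k]+\sum_i Q_i[k]Y_i[k]$, breaking ties in favor of the smallest row index; \item choose $\gamma[k]\in[\gamma_{min},\gamma_{max}]$ to minimize $\gamma[k]\bigl(-vR[k]+J[k]T[k]+\sum_iQ_i[k]Y_i[k]\bigr)+\frac{\gamma[k-1]\alpha v^2}{2}(\gamma[k]-\gamma[k-1])^2$, that is, $\gamma[k]=\Bigl[\gamma[k-1]+\frac{vR[k]-J[k]T[k]-\sum_iQ_i[k]Y_i[k]}{\gamma[k-1]\alpha v^2}\Bigr]_{\gamma_{min}}^{\gamma_{max}}$; \item update $Q_i[k+1]=[Q_i[k]+Y_i[k]]_0^{q_iv}$ for all $i$ and $J[k+1]=\max(0,\,J[k]+T[k]-1/\gamma[k])$. \end{itemize} Let $\overline R[m]=\frac1m\sum_{k=1}^mR[k]$ and $\overline T[m]=\frac1m\sum_{k=1}^mT[k]$.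 Define $$b=\tfrac12\bigl[c^2+(t_{max}-t_{min})^2\bigr],\qquad \beta_1=\frac{1+r_{max}+\sum_{i=1}^nq_iy_{i,min}}{t_{min}},\qquad \beta_2=\frac1v\bigl\lceil\alpha v\gamma_{max}(\gamma_{max}-\gamma_{min})\bigr\rceil(t_{max}-t_{min}),$$ $$d_1=\frac{b+\frac{1}{2\gamma_{min}^2\alpha}\bigl(r_{max}+c\|q\|+(t_{max}-t_{min})(\beta_1+\beta_2)\bigr)^2}{t_{min}} .$$ \textbf{Lemma (sample path limit).} Suppose the deterministic problem is feasible with optimal solution $(t^*,r^*,y^*)\in\overline\Gamma$ and optimal objective value $\theta^*=r^*/t^*$. Then for any parameters $v>0$, $\alpha>0$, $q\ge0$, the algorithm yields $$\liminf_{m\to\infty}\frac{\overline R[m]}{\overline T[m]}\ \ge\ \theta^*-\frac{d_1}{v}\qquad\text{with probability }1 .$$ -/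

import Mathlib

open MeasureTheory ProbabilityTheory Filter

namespace Renewal

/-- Vectors `(t, r, y)` in `ℝ^(n+2)`: duration, reward and penalty vector.  The penalty part carries
the Euclidean norm. -/
abbrev Vec (n : ℕ) : Type := ℝ × ℝ × EuclideanSpace ℝ (Fin n)

/-- Task matrices with a positive finite number of rows and `n + 2` columns.  The element `⟨m, a⟩`
is the matrix with the `m + 1` rows `a 0, …, a m`. -/
abbrev TaskMatrix (n : ℕ) : Type := (m : ℕ) × (Fin (m + 1) → Vec n)

/-- The set of rows of a task matrix. -/
def rowSet {n : ℕ} (a : TaskMatrix n) : Set (Vec n) := Set.range a.2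

/-- The constants of the boundedness assumptions and the parameters `v`, `α`, `q` of the
algorithm. -/
structure Params (n : ℕ) where
  tmin : ℝ
  tmax : ℝ
  rmax : ℝ
  c : ℝ
  ymin : Fin n → ℝ
  ymax : Fin n → ℝ
  v : ℝ
  α : ℝ
  q : EuclideanSpace ℝ (Fin n)

namespace Params

variable {n : ℕ} (p : Params n)

/-- The sign requirements on the constants and parameters. -/
structure Admissible : Prop where
  tmin_pos : 0 < p.tmin
  tmax_nonneg : 0 ≤ p.tmax
  rmax_nonneg : 0 ≤ p.rmax
  c_nonneg : 0 ≤ p.c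
  ymin_nonneg : ∀ i, 0 ≤ p.ymin i
  ymax_nonneg : ∀ i, 0 ≤ p.ymax i
  v_pos : 0 < p.v
  α_pos : 0 < p.α
  q_nonneg : ∀ i, 0 ≤ p.q i

/-- The boundedness assumptions on a vector `(t, r, y)`. -/
structure Bounded (x : Vec n) : Prop where
  tmin_le : p.tmin ≤ x.1
  le_tmax : x.1 ≤ p.tmax
  reward_nonneg : 0 ≤ x.2.1
  reward_le : x.2.1 ≤ p.rmax
  norm_le : ‖x.2.2‖ ≤ p.c
  neg_ymin_le : ∀ i, -p.ymin i ≤ x.2.2 i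
  le_ymax : ∀ i, x.2.2 i ≤ p.ymax i

noncomputable def γmin : ℝ := 1 / p.tmax

noncomputable def γmax : ℝ := 1 / p.tmin

noncomputable def b : ℝ := (1 / 2) * (p.c ^ 2 + (p.tmax - p.tmin) ^ 2)

noncomputable def β₁ : ℝ := (1 + p.rmax + ∑ i, p.q i * p.ymin i) / p.tmin

noncomputable def β₂ : ℝ :=
  (1 / p.v) * (⌈p.α * p.v * p.γmax * (p.γmax - p.γmin)⌉ : ℝ) * (p.tmax - p.tmin)

noncomputable def d₁ : ℝ :=
  (p.b + 1 / (2 * p.γmin ^ 2 * p.α)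
      * (p.rmax + p.c * ‖p.q‖ + (p.tmax - p.tmin) * (p.β₁ + p.β₂)) ^ 2) / p.tmin

end Params

/-- Projection of the real number `z` onto the interval `[lo, hi]` (for `lo ≤ hi`). -/
noncomputable def proj (lo hi z : ℝ) : ℝ := max lo (min z hi)

/-- What the algorithm remembers at the start of task `k`: the virtual queues `Q[k]`, `J[k]` and the
auxiliary variable `γ[k-1]`. -/
structure State (n : ℕ) where
  Q : Fin n → ℝ
  J : ℝ
  γ : ℝ

section Algorithm

variable {n : ℕ} (p : Params n)

/-- The quantity `-v r + J t + Qᵀ y`, for the current queues `Q`, `J`. -/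
noncomputable def cost (s : State n) (x : Vec n) : ℝ :=
  -p.v * x.2.1 + s.J * x.1 + ∑ i, s.Q i * x.2.2 i

/-- The rows at which the cost is minimal. -/
noncomputable def minimizers (s : State n) (a : TaskMatrix n) : Finset (Fin (a.1 + 1)) :=
  Finset.univ.filter fun r => ∀ r', cost p s (a.2 r) ≤ cost p s (a.2 r')

theorem minimizers_nonempty (s : State n) (a : TaskMatrix n) : (minimizers p s a).Nonempty := by
  obtain ⟨r, -, hr⟩ := Finset.exists_min_image Finset.univ (fun r => cost p s (a.2 r))
    Finset.univ_nonempty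
  exact ⟨r, by simpa [minimizers] using hr⟩

/-- Row selection: a row of minimal cost, ties being broken in favor of the smallest index. -/
noncomputable def selectRow (s : State n) (a : TaskMatrix n) : Vec n :=
  a.2 ((minimizers p s a).min' (minimizers_nonempty p s a))

/-- The objective that the choice `g` of `γ[k]` has to minimize over `[γmin, γmax]`, when `x` is the
selected row. -/
noncomputable def gammaObjective (s : State n) (x : Vec n) (g : ℝ) : ℝ :=
  g * cost p s x + s.γ * p.α * p.v ^ 2 / 2 * (g - s.γ) ^ 2

/-- The choice of `γ[k]`: the explicit minimizer of `gammaObjective` over `[γmin, γmax]`. -/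
noncomputable def gammaNext (s : State n) (x : Vec n) : ℝ :=
  proj p.γmin p.γmax (s.γ + (-cost p s x) / (s.γ * p.α * p.v ^ 2))

/-- `gammaNext` is the unique minimizer of `gammaObjective` over `[γmin, γmax]`. -/
theorem gammaNext_unique_minimizer (s : State n) (x : Vec n) (hv : 0 < p.v) (hα : 0 < p.α)
    (hs : 0 < s.γ) (hγ : p.γmin ≤ p.γmax) :
    gammaNext p s x ∈ Set.Icc p.γmin p.γmax ∧
      ∀ g ∈ Set.Icc p.γmin p.γmax, g ≠ gammaNext p s x →
        gammaObjective p s x (gammaNext p s x) < gammaObjective p s x g := by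
  have hw : 0 < s.γ * p.α * p.v ^ 2 := by positivity
  unfold gammaNext gammaObjective proj
  set w := s.γ * p.α * p.v ^ 2
  set K := cost p s x
  obtain ⟨z, hz⟩ : ∃ z, z = s.γ + (-K) / w := ⟨_, rfl⟩
  rw [← hz]
  have hK : K = w * (s.γ - z) := by rw [hz]; field_simp; ring
  refine ⟨⟨le_max_left _ _, max_le hγ (min_le_right _ _)⟩, fun g hg hne => ?_⟩
  obtain ⟨h, hh⟩ : ∃ h, h = max p.γmin (min z p.γmax) := ⟨_, rfl⟩
  rw [← hh] at hne ⊢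
  have key : 0 ≤ (g - h) * (h - z) := by
    rcases le_total z p.γmax with h1 | h1
    · rcases le_total p.γmin z with h2 | h2
      · have : h = z := by rw [hh, min_eq_left h1, max_eq_right h2]
        simp [this]
      · have : h = p.γmin := by rw [hh, min_eq_left h1, max_eq_left h2]
        rw [this]; exact mul_nonneg (by linarith [hg.1]) (by linarith)
    · have : h = p.γmax := by rw [hh, min_eq_right h1, max_eq_right hγ]
      rw [this]; exact mul_nonneg_of_nonpos_of_nonpos (by linarith [hg.2]) (by linarith)
  have hsq : 0 < (g - h) ^ 2 := by
    have : g - h ≠ 0 := sub_ne_zero.mpr hne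
    positivity
  rw [hK]
  nlinarith [mul_nonneg hw.le key, mul_pos hw hsq]

/-- The initial state `Q[1] = 0`, `J[1] = 0`, `γ[0] = γmin`. -/
noncomputable def initState : State n := ⟨fun _ => 0, 0, p.γmin⟩

/-- One task of the algorithm, with task matrix `a`: row selection, `γ` selection, and update of the
virtual queues. -/
noncomputable def step (s : State n) (a : TaskMatrix n) : State n where
  Q i := proj 0 (p.q i * p.v) (s.Q i + (selectRow p s a).2.2 i)
  J := max 0 (s.J + (selectRow p s a).1 - 1 / gammaNext p s (selectRow p s a))
  γ := gammaNext p s (selectRow p s a)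

/-- The state before the task with index `k`, when the algorithm runs on the task matrices
`a 0, a 1, …`.  (Tasks are indexed from `0`: the `k`-th task is the one with index `k - 1`.) -/
noncomputable def state (a : ℕ → TaskMatrix n) : ℕ → State n
  | 0 => initState p
  | k + 1 => step p (state a k) (a k)

/-- The vector `(T, R, Y)` that the algorithm selects for the task with index `k`. -/
noncomputable def decision (a : ℕ → TaskMatrix n) (k : ℕ) : Vec n :=
  selectRow p (state p a k) (a k)

/-- The average duration of the first `m` tasks. -/
noncomputable def avgT (a : ℕ → TaskMatrix n) (m : ℕ) : ℝ :=
  (1 / (m : ℝ)) * ∑ k ∈ Finset.range m, (decision p a k).1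

/-- The average reward of the first `m` tasks. -/
noncomputable def avgR (a : ℕ → TaskMatrix n) (m : ℕ) : ℝ :=
  (1 / (m : ℝ)) * ∑ k ∈ Finset.range m, (decision p a k).2.1

end Algorithm

/-- The set `Γ` of the expectations of all decision vectors for a task with random matrix `A`, a
decision vector being a random vector on the probability space whose value is always a row of `A`
(so the choice of the row may use any randomness in the space). -/
def Gamma {n : ℕ} {Ω : Type*} [MeasurableSpace Ω] (μ : Measure Ω) (A : Ω → TaskMatrix n) :
    Set (Vec n) :=
  {x | ∃ D : Ω → Vec n, Measurable D ∧ (∀ ω, D ω ∈ rowSet (A ω)) ∧ x = ∫ ω, D ω ∂μ}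

/-- The feasible set of the deterministic problem: maximize `r / t` subject to `y ≤ 0` and
`(t, r, y) ∈ closure G`. -/
def detFeasible {n : ℕ} (G : Set (Vec n)) : Set (Vec n) :=
  {x | x ∈ closure G ∧ ∀ i, x.2.2 i ≤ 0}

/-- `x` is an optimal solution of the deterministic problem. -/
def IsDetOptimal {n : ℕ} (G : Set (Vec n)) (x : Vec n) : Prop :=
  x ∈ detFeasible G ∧ ∀ x' ∈ detFeasible G, x'.2.1 / x'.1 ≤ x.2.1 / x.1

/-- The stochastic assumptions: the random matrices `A 0, A 1, …` are i.i.d., all their rows surely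
satisfy the boundedness assumptions, and `U` is uniform on `[0, 1]` and independent of the sequence
of matrices. -/
structure StochasticAssumptions {n : ℕ} {Ω : Type*} [MeasurableSpace Ω] (μ : Measure Ω)
    (p : Params n) (A : ℕ → Ω → TaskMatrix n) (U : Ω → ℝ) : Prop where
  measurable_A : ∀ k, Measurable (A k)
  indep : iIndepFun A μ
  identDistrib : ∀ k, IdentDistrib (A k) (A 0) μ μ
  bounded : ∀ k ω, ∀ x ∈ rowSet (A k ω), p.Bounded x
  measurable_U : Measurable U
  U_mem : ∀ ω, U ω ∈ Set.Icc (0 : ℝ) 1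
  U_uniform : μ.map U = (volume : Measure ℝ).restrict (Set.Icc 0 1)
  U_indep : IndepFun U (fun ω k => A k ω) μ

end Renewal

/-! The proof is a drift-plus-penalty argument with L = (‖Q‖² + J²)/2. The cost of a row is linear
in the row and the selected row minimizes it. Hence, given the past, its mean is at most the cost of
every point of `Gamma`, and by continuity at most the cost of (t*, r*, y*), which is at most -v r* +
J t* because Q ≥ 0 and y* ≤ 0 (`meanCost_le`).

The proximal choice of γ[k] is compared with the constant choice 1/t*. Divided by γ[k-1], its
optimality inequality carries squares with the constant weight α v²/2, and these telescope. Combined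
with the growth of L and with Young's inequality for the cross term in γ[k] - γ[k-1], it gives
`drift_le`: each task loses at most d₁ t_min, up to the deviation of the realized cost from its
conditional mean.

Young's inequality needs a sure bound on J. If J ≥ v β₁, the cost is at least v, so γ falls by a
fixed amount per task until it is γ_min; then 1/γ = t_max and J no longer grows (`Reachable.step`).
The same bound makes ∑ 1/γ[k-1] an upper bound for ∑ T[k] up to a constant.

The deviations are bounded martingale differences, hence orthogonal, and their averages vanish
almost surely (`ae_tendsto_avg_deviation`). Summing, dividing by m and using ∑ T[k] ≥ m t_min gives
the liminf bound. -/

namespace Renewal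

/-! ### A strong law for bounded orthogonal variables -/

/-- If `S (m ^ 2) / m ^ 2 → 0` and `S` has bounded increments, then `S m / m → 0`. -/
theorem tendsto_div_of_tendsto_sq {S : ℕ → ℝ} {C : ℝ} (hC : ∀ m, |S (m + 1) - S m| ≤ C)
    (h : Tendsto (fun m : ℕ => S (m ^ 2) / (m : ℝ) ^ 2) atTop (nhds 0)) :
    Tendsto (fun m : ℕ => S m / m) atTop (nhds 0) := by
  have hC0 : 0 ≤ C := (abs_nonneg _).trans (hC 0)
  have hinc : ∀ m d, |S (m + d) - S m| ≤ d * C := by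
    intro m d
    induction d with
    | zero => simp
    | succ d ih =>
      have h1 := hC (m + d)
      have h2 := abs_add_le (S (m + d + 1) - S (m + d)) (S (m + d) - S m)
      rw [sub_add_sub_cancel] at h2
      push_cast
      rw [← add_assoc]
      linarith
  have hsqrt : Tendsto Nat.sqrt atTop atTop :=
    tendsto_atTop_atTop.2 fun b => ⟨b * b, fun a h => Nat.le_sqrt.2 h⟩
  have hlim : Tendsto (fun m : ℕ => |S (m.sqrt ^ 2) / ((m.sqrt : ℕ) : ℝ) ^ 2|
      + 2 * C / ((m.sqrt : ℕ) : ℝ)) atTop (nhds 0) := by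
    have h1 := (h.comp hsqrt).abs
    have h2 := (tendsto_const_div_atTop_nhds_zero_nat (2 * C)).comp hsqrt
    simpa using h1.add h2
  refine squeeze_zero_norm' ?_ hlim
  filter_upwards [eventually_ge_atTop 1] with N hN
  set s := N.sqrt with hs
  have hs1 : 1 ≤ s := Nat.le_sqrt.2 (by simpa using hN)
  have hsN : s ^ 2 ≤ N := by simpa [pow_two] using Nat.sqrt_le N
  -- Consecutive squares are 2s + 1 apart, so S changes by at most 2sC between s² and N, which is
  -- negligible against s².
  have hNs : N ≤ s ^ 2 + 2 * s := by
    have := Nat.sqrt_le_add N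
    rw [← hs] at this
    nlinarith
  obtain ⟨d, hd⟩ := Nat.exists_eq_add_of_le hsN
  have hds : (d : ℝ) ≤ 2 * s := by
    have : d ≤ 2 * s := by omega
    exact_mod_cast this
  have hspos : (0 : ℝ) < s := by exact_mod_cast hs1
  have hNpos : (0 : ℝ) < N := by exact_mod_cast hN
  have hsN' : (s : ℝ) ^ 2 ≤ N := by exact_mod_cast hsN
  have hb : |S N| ≤ |S (s ^ 2)| + 2 * s * C := by
    have h1 := hinc (s ^ 2) d
    rw [← hd] at h1
    have h2 := abs_add_le (S N - S (s ^ 2)) (S (s ^ 2))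
    rw [sub_add_cancel] at h2
    nlinarith
  rw [Real.norm_eq_abs, abs_div, abs_of_pos hNpos, abs_div, abs_of_pos (pow_pos hspos 2)]
  calc |S N| / N ≤ (|S (s ^ 2)| + 2 * s * C) / N := by gcongr
    _ ≤ (|S (s ^ 2)| + 2 * s * C) / (s : ℝ) ^ 2 := by gcongr
    _ = |S (s ^ 2)| / (s : ℝ) ^ 2 + 2 * C / s := by field_simp

variable {Ω : Type*} [MeasurableSpace Ω] {μ : Measure Ω} [IsProbabilityMeasure μ]

/-- Second moment of a sum of bounded orthogonal random variables. -/
theorem integral_sum_sq_le_of_orthogonal {X : ℕ → Ω → ℝ} (hX : ∀ k, Measurable (X k)) {C : ℝ}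
    (hC : ∀ k ω, |X k ω| ≤ C) (horth : ∀ j k, j < k → ∫ ω, X j ω * X k ω ∂μ = 0) (m : ℕ) :
    ∫ ω, (∑ k ∈ Finset.range m, X k ω) ^ 2 ∂μ ≤ m * C ^ 2 := by
  have hbdd : ∀ i j, Integrable (fun ω => X i ω * X j ω) μ := by
    intro i j
    refine Integrable.of_bound ((hX i).mul (hX j)).aestronglyMeasurable (C * C)
      (ae_of_all _ fun ω => ?_)
    rw [norm_mul]
    exact mul_le_mul (hC i ω) (hC j ω) (abs_nonneg _) ((abs_nonneg _).trans (hC i ω))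
  have hsq : ∀ m, Integrable (fun ω => (∑ k ∈ Finset.range m, X k ω) ^ 2) μ := by
    intro m
    simp_rw [pow_two, Finset.sum_mul_sum]
    exact integrable_finsetSum _ fun i _ => integrable_finsetSum _ fun j _ => hbdd i j
  induction m with
  | zero => simp
  | succ m ih =>
    have hcross : Integrable (fun ω => 2 * ∑ k ∈ Finset.range m, X k ω * X m ω) μ :=
      (integrable_finsetSum _ fun i _ => hbdd i m).const_mul 2
    have heq : (fun ω => (∑ k ∈ Finset.range (m + 1), X k ω) ^ 2) = fun ω =>
        (∑ k ∈ Finset.range m, X k ω) ^ 2 + 2 * ∑ k ∈ Finset.range m, X k ω * X m ω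
          + X m ω * X m ω := by
      funext ω
      rw [Finset.sum_range_succ, ← Finset.sum_mul]
      ring
    have hm : ∫ ω, X m ω * X m ω ∂μ ≤ C ^ 2 := by
      calc ∫ ω, X m ω * X m ω ∂μ ≤ ∫ _, C ^ 2 ∂μ := by
            refine integral_mono (hbdd m m) (integrable_const _) fun ω => ?_
            simp only
            rw [← pow_two, ← sq_abs]
            exact pow_le_pow_left₀ (abs_nonneg _) (hC m ω) 2
        _ = C ^ 2 := by simp
    have hadd : Integrable (fun ω => (∑ k ∈ Finset.range m, X k ω) ^ 2
        + 2 * ∑ k ∈ Finset.range m, X k ω * X m ω) μ := (hsq m).add hcross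
    rw [heq, integral_add hadd (hbdd m m), integral_add (hsq m) hcross,
      integral_const_mul, integral_finsetSum _ fun i _ => hbdd i m,
      Finset.sum_eq_zero fun i hi => horth i m (Finset.mem_range.1 hi)]
    push_cast
    linarith

/-- Strong law of large numbers for bounded orthogonal random variables. -/
theorem ae_tendsto_avg_of_orthogonal {X : ℕ → Ω → ℝ} (hX : ∀ k, Measurable (X k)) {C : ℝ}
    (hC : ∀ k ω, |X k ω| ≤ C) (horth : ∀ j k, j < k → ∫ ω, X j ω * X k ω ∂μ = 0) :
    ∀ᵐ ω ∂μ, Tendsto (fun m : ℕ => (∑ k ∈ Finset.range m, X k ω) / m) atTop (nhds 0) := by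
  let S : ℕ → Ω → ℝ := fun m ω => ∑ k ∈ Finset.range m, X k ω
  have hS : ∀ m, Measurable (S m) := fun m => Finset.measurable_sum _ fun k _ => hX k
  have hSb : ∀ m ω, |S m ω| ≤ m * C := by
    intro m ω
    calc |S m ω| ≤ ∑ k ∈ Finset.range m, |X k ω| := Finset.abs_sum_le_sum_abs _ _
      _ ≤ ∑ k ∈ Finset.range m, C := Finset.sum_le_sum fun k _ => hC k ω
      _ = m * C := by simp
  let f : ℕ → Ω → ℝ := fun m ω => (S (m ^ 2) ω / (m : ℝ) ^ 2) ^ 2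
  have hf : ∀ m, Measurable (f m) := fun m => ((hS _).div_const _).pow_const 2
  have hfint : ∀ m, Integrable (f m) μ := by
    intro m
    refine Integrable.of_bound (hf m).aestronglyMeasurable
      ((((m ^ 2 : ℕ) : ℝ) * C / (m : ℝ) ^ 2) ^ 2) (ae_of_all _ fun ω => ?_)
    simp only [f]
    rw [norm_pow, norm_div, Real.norm_eq_abs, Real.norm_eq_abs, abs_of_nonneg (sq_nonneg (m : ℝ))]
    gcongr
    exact hSb _ ω
  have hfle : ∀ m, ∫⁻ ω, ENNReal.ofReal (f m ω) ∂μ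
      ≤ ENNReal.ofReal (C ^ 2 * (1 / (m : ℝ) ^ 2)) := by
    intro m
    rw [← ofReal_integral_eq_lintegral_ofReal (hfint m) (ae_of_all _ fun ω => sq_nonneg _)]
    apply ENNReal.ofReal_le_ofReal
    simp only [f, div_pow]
    rw [integral_div]
    have := integral_sum_sq_le_of_orthogonal hX hC horth (m ^ 2)
    rcases Nat.eq_zero_or_pos m with rfl | hm
    · simp
    · have hm' : (0 : ℝ) < m := by exact_mod_cast hm
      rw [div_le_iff₀ (by positivity)]
      refine this.trans (le_of_eq ?_)
      push_cast
      field_simp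
  -- Along squares the second moments are at most C²/m², which is summable. The series of squares is
  -- therefore finite almost everywhere, and its terms tend to 0.
  have hsum : ∫⁻ ω, ∑' m, ENNReal.ofReal (f m ω) ∂μ ≠ ⊤ := by
    rw [lintegral_tsum fun m => (hf m).ennreal_ofReal.aemeasurable]
    refine ne_top_of_le_ne_top ?_ (ENNReal.tsum_le_tsum hfle)
    have : Summable fun m : ℕ => C ^ 2 * (1 / (m : ℝ) ^ 2) :=
      (Real.summable_one_div_nat_pow.2 one_lt_two).mul_left _
    exact this.tsum_ofReal_ne_top
  filter_upwards [ae_lt_top (Measurable.tsum fun m => (hf m).ennreal_ofReal) hsum] with ω hω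
  have h0 := ENNReal.tendsto_atTop_zero_of_tsum_ne_top hω.ne
  refine tendsto_div_of_tendsto_sq (S := fun m => S m ω) (C := C) (fun m => ?_) ?_
  · simp only [S, Finset.sum_range_succ, add_sub_cancel_left]
    exact hC m ω
  · have h1 := (ENNReal.tendsto_toReal ENNReal.zero_ne_top).comp h0
    have h2 : Tendsto (fun m => f m ω) atTop (nhds 0) := by
      refine (by simpa using h1 : Tendsto _ _ _).congr fun m => ?_
      simp [f, sq_nonneg]
    have h3 := h2.sqrt
    simp only [f, Real.sqrt_sq_eq_abs, Real.sqrt_zero] at h3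
    exact (tendsto_zero_iff_abs_tendsto_zero _).2 h3

end Renewal

/-! ### Measurability of the algorithm and its dependence on the past -/

namespace Renewal

variable {n : ℕ} (p : Params n)

/-- The state as a tuple. -/
def State.toTuple (s : State n) : (Fin n → ℝ) × ℝ × ℝ := (s.Q, s.J, s.γ)

instance State.instMeasurableSpace : MeasurableSpace (State n) :=
  MeasurableSpace.comap State.toTuple inferInstance

theorem State.measurable_toTuple : Measurable (State.toTuple (n := n)) :=
  comap_measurable _

theorem State.measurable_Q (i : Fin n) : Measurable fun s : State n => s.Q i :=
  (measurable_pi_apply i).comp (measurable_fst.comp State.measurable_toTuple)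

theorem State.measurable_J : Measurable fun s : State n => s.J :=
  measurable_fst.comp (measurable_snd.comp State.measurable_toTuple)

theorem State.measurable_γ : Measurable fun s : State n => s.γ :=
  measurable_snd.comp (measurable_snd.comp State.measurable_toTuple)

theorem State.measurable_iff {β : Type*} [MeasurableSpace β] {f : β → State n}
    (hQ : ∀ i, Measurable fun b => (f b).Q i) (hJ : Measurable fun b => (f b).J)
    (hγ : Measurable fun b => (f b).γ) : Measurable f :=
  measurable_comap_iff.2 ((measurable_pi_lambda _ hQ).prodMk (hJ.prodMk hγ))

theorem measurable_sigma_dom {ι : Type*} {F : ι → Type*} [∀ i, MeasurableSpace (F i)]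
    {β : Type*} [MeasurableSpace β] {f : Sigma F → β} (hf : ∀ i, Measurable fun x => f ⟨i, x⟩) :
    Measurable f := by
  intro s hs
  exact MeasurableSpace.measurableSet_iInf.2 fun i => hf i hs

/-- Measurability of functions on the product with a countable sigma type can be checked on the
summands. -/
theorem measurable_prod_sigma {ι : Type*} [Countable ι] {F : ι → Type*}
    [∀ i, MeasurableSpace (F i)] [∀ i, Inhabited (F i)] {α β : Type*} [MeasurableSpace α]
    [MeasurableSpace β] {f : α × Sigma F → β}
    (hf : ∀ i, Measurable fun z : α × F i => f (z.1, ⟨i, z.2⟩)) : Measurable f := by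
  classical
  let : MeasurableSpace ι := ⊤
  -- A retraction onto each summand. The index becomes a separate countable discrete coordinate; the
  -- default value is never used, since `g i` is only applied on its own summand.
  let g : ∀ i, Sigma F → F i := fun i x => if h : x.1 = i then h ▸ x.2 else default
  have hg : ∀ i, Measurable (g i) := by
    intro i
    refine measurable_sigma_dom fun j => ?_
    by_cases h : j = i
    · subst h
      simpa [g] using measurable_id'
    · simp [g, h]
  have hG : Measurable fun z : ι × (α × Sigma F) => f (z.2.1, ⟨z.1, g z.1 z.2.2⟩) :=
    measurable_from_prod_countable_right fun i =>
      (hf i).comp (measurable_fst.prodMk ((hg i).comp measurable_snd))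
  have h1 : Measurable fun x : Sigma F => x.1 := measurable_sigma_dom fun i => measurable_const
  have h2 := hG.comp ((h1.comp measurable_snd).prodMk (measurable_id (α := α × Sigma F)))
  convert h2 using 1
  funext ⟨a, ⟨i, x⟩⟩
  simp [g]

theorem measurable_coord (i : Fin n) : Measurable fun x : Vec n => x.2.2 i := by
  have : Measurable fun y : EuclideanSpace ℝ (Fin n) => y i :=
    (EuclideanSpace.proj (𝕜 := ℝ) i).continuous.measurable
  exact this.comp (measurable_snd.comp measurable_snd)

theorem measurable_cost : Measurable fun z : State n × Vec n => cost p z.1 z.2 := by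
  unfold cost
  refine Measurable.add (Measurable.add ?_ ?_) (Finset.measurable_sum _ fun i _ => ?_)
  · exact (measurable_fst.comp (measurable_snd.comp measurable_snd)).const_mul _
  · exact (State.measurable_J.comp measurable_fst).mul (measurable_fst.comp measurable_snd)
  · exact ((State.measurable_Q i).comp measurable_fst).mul
      ((measurable_coord i).comp measurable_snd)

theorem mem_minimizers {s : State n} {a : TaskMatrix n} {r : Fin (a.1 + 1)} :
    r ∈ minimizers p s a ↔ ∀ r', cost p s (a.2 r) ≤ cost p s (a.2 r') := by
  simp [minimizers]

theorem measurable_selectRow :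
    Measurable fun z : State n × TaskMatrix n => selectRow p z.1 z.2 := by
  refine measurable_prod_sigma fun m => ?_
  have hc : ∀ r, Measurable fun z : State n × (Fin (m + 1) → Vec n) => cost p z.1 (z.2 r) :=
    fun r => (measurable_cost p).comp
      (measurable_fst.prodMk ((measurable_pi_apply r).comp measurable_snd))
  have hmem : ∀ r : Fin (m + 1), MeasurableSet {z : State n × (Fin (m + 1) → Vec n) |
      r ∈ minimizers p z.1 ⟨m, z.2⟩} := by
    intro r
    simp only [mem_minimizers, Set.ofPred_forall]
    exact MeasurableSet.iInter fun r' => measurableSet_le (hc r) (hc r')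
  let idx : State n × (Fin (m + 1) → Vec n) → Fin (m + 1) := fun z =>
    (minimizers p z.1 ⟨m, z.2⟩).min' (minimizers_nonempty p z.1 ⟨m, z.2⟩)
  have hidx : Measurable idx := by
    refine measurable_to_countable' fun r => ?_
    -- Index r is selected exactly when it is a minimizer and no smaller index is; both are finite
    -- combinations of comparisons of costs.
    have : idx ⁻¹' {r} = {z | r ∈ minimizers p z.1 ⟨m, z.2⟩} ∩
        ⋂ r' : Fin (m + 1), {z | r' ∈ minimizers p z.1 ⟨m, z.2⟩ → r ≤ r'} := by
      ext z
      simp only [Set.mem_preimage, Set.mem_singleton_iff, Set.mem_inter_iff, Set.mem_ofPred_eq,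
        Set.mem_iInter]
      exact Finset.min'_eq_iff _ _ _
    rw [this]
    refine (hmem r).inter (MeasurableSet.iInter fun r' => ?_)
    by_cases h : r ≤ r'
    · simp [h]
    · simp only [h, imp_false]
      exact (hmem r').compl
  have hev : Measurable fun w : Fin (m + 1) × (Fin (m + 1) → Vec n) => w.2 w.1 :=
    measurable_from_prod_countable_right fun r => measurable_pi_apply r
  exact hev.comp (hidx.prodMk measurable_snd)

theorem measurable_proj {β : Type*} [MeasurableSpace β] {f : β → ℝ} (hf : Measurable f)
    (lo hi : ℝ) : Measurable fun b => proj lo hi (f b) :=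
  measurable_const.max (hf.min measurable_const)

theorem measurable_gammaNext : Measurable fun z : State n × Vec n => gammaNext p z.1 z.2 := by
  have hγ : Measurable fun z : State n × Vec n => z.1.γ := State.measurable_γ.comp measurable_fst
  exact measurable_proj (hγ.add ((measurable_cost p).neg.div ((hγ.mul_const _).mul_const _))) _ _

theorem measurable_step : Measurable fun z : State n × TaskMatrix n => step p z.1 z.2 := by
  have hx := measurable_selectRow p
  have hg := (measurable_gammaNext p).comp (measurable_fst.prodMk hx)
  refine State.measurable_iff (fun i => ?_) ?_ hg
  · exact measurable_proj (((State.measurable_Q i).comp measurable_fst).add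
      ((measurable_coord i).comp hx)) _ _
  · exact measurable_const.max (((State.measurable_J.comp measurable_fst).add
      (measurable_fst.comp hx)).sub (hg.const_div 1))

theorem measurable_state (k : ℕ) : Measurable fun a : ℕ → TaskMatrix n => state p a k := by
  induction k with
  | zero => exact measurable_const
  | succ k ih => exact (measurable_step p).comp (ih.prodMk (measurable_pi_apply k))

theorem state_congr {a a' : ℕ → TaskMatrix n} {k : ℕ} (h : ∀ i < k, a i = a' i) :
    state p a k = state p a' k := by
  induction k with
  | zero => rfl
  | succ k ih =>
    simp only [state, ih fun i hi => h i (hi.trans k.lt_succ_self), h k k.lt_succ_self]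

/-- Extension of a finite history of task matrices to a sequence. -/
noncomputable def extendHistory (k : ℕ) (h : Finset.range k → TaskMatrix n) (i : ℕ) :
    TaskMatrix n :=
  -- The padding matrix need not satisfy the boundedness assumptions; states up to time k never read
  -- it.
  if hi : i ∈ Finset.range k then h ⟨i, hi⟩ else ⟨0, fun _ => 0⟩

theorem measurable_extendHistory (k : ℕ) : Measurable (extendHistory (n := n) k) := by
  refine measurable_pi_lambda _ fun i => ?_
  unfold extendHistory
  by_cases hi : i ∈ Finset.range k
  · simpa only [hi, dite_true] using measurable_pi_apply _
  · simpa only [hi, dite_false] using measurable_const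

theorem extendHistory_apply {k i : ℕ} (hi : i < k) (a : ℕ → TaskMatrix n) :
    extendHistory k (fun j => a j) i = a i := by
  simp [extendHistory, hi]

/-- Exhibits the states up to time k as functions of the first k matrices alone, the form in which
independence of `A k` can be applied. -/
theorem state_extendHistory {k j : ℕ} (hj : j ≤ k) (a : ℕ → TaskMatrix n) :
    state p (extendHistory k fun i => a i) j = state p a j :=
  state_congr p fun _ hi => extendHistory_apply (hi.trans_le hj) a

end Renewal

/-! ### Sure bounds on the queues and the drift of one task -/

namespace Renewal

theorem proj_mem {lo hi : ℝ} (h : lo ≤ hi) (z : ℝ) : proj lo hi z ∈ Set.Icc lo hi :=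
  ⟨le_max_left _ _, max_le h (min_le_right _ _)⟩

theorem proj_le_max (lo hi z : ℝ) : proj lo hi z ≤ max lo z :=
  max_le_max le_rfl (min_le_left _ _)

/-- The variational inequality of the projection onto an interval. -/
theorem proj_variational {lo hi g : ℝ} (hg : g ∈ Set.Icc lo hi) (z : ℝ) :
    0 ≤ (g - proj lo hi z) * (proj lo hi z - z) := by
  have hlh : lo ≤ hi := hg.1.trans hg.2
  unfold proj
  rcases le_total z hi with h1 | h1
  · rcases le_total lo z with h2 | h2
    · rw [min_eq_left h1, max_eq_right h2]
      simp
    · rw [min_eq_left h1, max_eq_left h2]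
      exact mul_nonneg (by linarith [hg.1]) (by linarith)
  · rw [min_eq_right h1, max_eq_right hlh]
    exact mul_nonneg_of_nonpos_of_nonpos (by linarith [hg.2]) (by linarith)

theorem proj_zero_sq_le (hi z : ℝ) : proj 0 hi z ^ 2 ≤ z ^ 2 := by
  unfold proj
  rcases le_total z 0 with hz | hz
  · rw [max_eq_left ((min_le_left _ _).trans hz), zero_pow two_ne_zero]
    exact sq_nonneg z
  · exact pow_le_pow_left₀ (le_max_left _ _) (max_le hz (min_le_left _ _)) 2

theorem max_zero_sq_le (z : ℝ) : max 0 z ^ 2 ≤ z ^ 2 := by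
  rcases le_total z 0 with hz | hz
  · rw [max_eq_left hz, zero_pow two_ne_zero]
    exact sq_nonneg z
  · rw [max_eq_right hz]

variable {n : ℕ} {p : Params n}

namespace Params

theorem Admissible.tmax_pos (hp : p.Admissible) (ht : p.tmin ≤ p.tmax) : 0 < p.tmax :=
  hp.tmin_pos.trans_le ht

theorem Admissible.γmin_pos (hp : p.Admissible) (ht : p.tmin ≤ p.tmax) : 0 < p.γmin :=
  one_div_pos.2 (hp.tmax_pos ht)

theorem Admissible.γmin_le_γmax (hp : p.Admissible) (ht : p.tmin ≤ p.tmax) : p.γmin ≤ p.γmax :=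
  one_div_le_one_div_of_le hp.tmin_pos ht

theorem Admissible.γmax_pos (hp : p.Admissible) : 0 < p.γmax :=
  one_div_pos.2 hp.tmin_pos

theorem Admissible.one_div_mem (hp : p.Admissible) (ht : p.tmin ≤ p.tmax) {g : ℝ}
    (hg : g ∈ Set.Icc p.γmin p.γmax) : 1 / g ∈ Set.Icc p.tmin p.tmax := by
  have h0 := hp.γmin_pos ht
  constructor
  · have := one_div_le_one_div_of_le (h0.trans_le hg.1) hg.2
    simpa [γmax] using this
  · have := one_div_le_one_div_of_le h0 hg.1
    simpa [γmin] using this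

theorem Admissible.one_div_mem' (hp : p.Admissible) {t : ℝ}
    (h : t ∈ Set.Icc p.tmin p.tmax) : 1 / t ∈ Set.Icc p.γmin p.γmax :=
  ⟨one_div_le_one_div_of_le (hp.tmin_pos.trans_le h.1) h.2,
    one_div_le_one_div_of_le hp.tmin_pos h.1⟩

theorem Admissible.β₁_nonneg (hp : p.Admissible) : 0 ≤ p.β₁ := by
  have h1 : 0 ≤ ∑ i, p.q i * p.ymin i :=
    Finset.sum_nonneg fun i _ => mul_nonneg (hp.q_nonneg i) (hp.ymin_nonneg i)
  have h2 := hp.rmax_nonneg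
  exact div_nonneg (by linarith) hp.tmin_pos.le

theorem Admissible.β₂_nonneg (hp : p.Admissible) (ht : p.tmin ≤ p.tmax) : 0 ≤ p.β₂ := by
  have h1 : 0 ≤ p.α * p.v * p.γmax * (p.γmax - p.γmin) :=
    mul_nonneg (mul_pos (mul_pos hp.α_pos hp.v_pos) hp.γmax_pos).le
      (sub_nonneg.2 (hp.γmin_le_γmax ht))
  have h2 : (0 : ℝ) ≤ ⌈p.α * p.v * p.γmax * (p.γmax - p.γmin)⌉ := by
    exact_mod_cast Int.ceil_nonneg h1
  exact mul_nonneg (mul_nonneg (one_div_nonneg.2 hp.v_pos.le) h2) (sub_nonneg.2 ht)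

/-- The maximal number of consecutive tasks with large `J` at which `J` can still grow. -/
noncomputable def climb (p : Params n) : ℤ := ⌈p.α * p.v * p.γmax * (p.γmax - p.γmin)⌉

theorem Admissible.v_mul_β₂ (hp : p.Admissible) :
    p.v * p.β₂ = p.climb * (p.tmax - p.tmin) := by
  have := hp.v_pos.ne'
  unfold β₂ climb
  field_simp

end Params

/-- Properties of the states that the algorithm visits. -/
structure Reachable (p : Params n) (s : State n) : Prop where
  Q_nonneg : ∀ i, 0 ≤ s.Q i
  Q_le : ∀ i, s.Q i ≤ p.q i * p.v
  γ_mem : s.γ ∈ Set.Icc p.γmin p.γmax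
  J_nonneg : 0 ≤ s.J
  -- Here j counts the tasks since J was last at most v β₁, capped at `climb`. The first of them
  -- starts below the threshold and need not lower γ, hence j - 1 decrements.
  J_climb : s.J ≤ p.v * p.β₁ ∨ ∃ j : ℕ, 1 ≤ j ∧ (j : ℤ) ≤ p.climb ∧
    s.J ≤ p.v * p.β₁ + j * (p.tmax - p.tmin) ∧
    s.γ ≤ max p.γmin (p.γmax - (j - 1) / (p.γmax * p.α * p.v))

namespace Reachable

variable {s : State n} {x : Vec n}

theorem J_le (hs : Reachable p s) (hp : p.Admissible) (ht : p.tmin ≤ p.tmax) :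
    s.J ≤ p.v * (p.β₁ + p.β₂) := by
  rw [mul_add]
  rcases hs.J_climb with h | ⟨j, -, hj, h, -⟩
  · linarith [mul_nonneg hp.v_pos.le (hp.β₂_nonneg ht)]
  · rw [hp.v_mul_β₂]
    have hj' : (j : ℝ) ≤ p.climb := by exact_mod_cast hj
    linarith [mul_le_mul_of_nonneg_right hj' (sub_nonneg.2 ht)]

theorem γ_pos (hs : Reachable p s) (hp : p.Admissible) (ht : p.tmin ≤ p.tmax) : 0 < s.γ :=
  (hp.γmin_pos ht).trans_le hs.γ_mem.1

theorem abs_sum_le (hs : Reachable p s) (hp : p.Admissible) (hx : p.Bounded x) :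
    |∑ i, s.Q i * x.2.2 i| ≤ p.v * (p.c * ‖p.q‖) := by
  have h0 : 0 ≤ p.v * (p.c * ‖p.q‖) :=
    mul_nonneg hp.v_pos.le (mul_nonneg hp.c_nonneg (norm_nonneg _))
  refine abs_le_of_sq_le_sq ?_ h0
  have hQ : ∑ i, s.Q i ^ 2 ≤ p.v ^ 2 * ‖p.q‖ ^ 2 := by
    rw [EuclideanSpace.norm_sq_eq, Finset.mul_sum]
    refine Finset.sum_le_sum fun i _ => ?_
    rw [Real.norm_eq_abs, sq_abs, ← mul_pow, mul_comm]
    exact pow_le_pow_left₀ (hs.Q_nonneg i) (hs.Q_le i) 2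
  have hy : ∑ i, x.2.2 i ^ 2 ≤ p.c ^ 2 := by
    have := pow_le_pow_left₀ (norm_nonneg _) hx.norm_le 2
    simpa [EuclideanSpace.norm_sq_eq] using this
  calc (∑ i, s.Q i * x.2.2 i) ^ 2 ≤ (∑ i, s.Q i ^ 2) * ∑ i, x.2.2 i ^ 2 :=
        Finset.sum_mul_sq_le_sq_mul_sq _ _ _
    _ ≤ (p.v ^ 2 * ‖p.q‖ ^ 2) * p.c ^ 2 :=
        mul_le_mul hQ hy (Finset.sum_nonneg fun _ _ => sq_nonneg _) (by positivity)
    _ = (p.v * (p.c * ‖p.q‖)) ^ 2 := by ring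

/-- β₁ is chosen for this: J t ≥ v β₁ t_min outweighs the reward and the worst queue term, and the
summand 1 in β₁ leaves the margin v. -/
theorem le_cost (hs : Reachable p s) (hp : p.Admissible) (hx : p.Bounded x)
    (hJ : p.v * p.β₁ ≤ s.J) : p.v ≤ cost p s x := by
  have h1 : p.v * (∑ i, p.q i * p.ymin i) ≥ -∑ i, s.Q i * x.2.2 i := by
    rw [Finset.mul_sum, ← Finset.sum_neg_distrib]
    refine Finset.sum_le_sum fun i _ => ?_
    have h2 := mul_le_mul_of_nonneg_left (hx.neg_ymin_le i) (hs.Q_nonneg i)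
    have h3 := mul_le_mul_of_nonneg_right (hs.Q_le i) (hp.ymin_nonneg i)
    linarith
  have h2 : p.v * p.β₁ * p.tmin = p.v * (1 + p.rmax + ∑ i, p.q i * p.ymin i) := by
    have := hp.tmin_pos.ne'
    unfold Params.β₁
    field_simp
  have h3 : p.v * p.β₁ * p.tmin ≤ s.J * x.1 :=
    mul_le_mul hJ hx.tmin_le hp.tmin_pos.le hs.J_nonneg
  have h4 := mul_le_mul_of_nonneg_left hx.reward_le hp.v_pos.le
  unfold cost
  nlinarith

theorem abs_cost_le (hs : Reachable p s) (hp : p.Admissible) (ht : p.tmin ≤ p.tmax)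
    (hx : p.Bounded x) :
    |cost p s x| ≤ p.v * (p.rmax + (p.β₁ + p.β₂) * p.tmax + p.c * ‖p.q‖) := by
  have h1 := abs_le.1 (hs.abs_sum_le hp hx)
  have h2 := mul_le_mul_of_nonneg_left hx.reward_le hp.v_pos.le
  have h3 := mul_nonneg hp.v_pos.le hx.reward_nonneg
  have hx0 : 0 ≤ x.1 := hp.tmin_pos.le.trans hx.tmin_le
  have h4 := mul_nonneg hs.J_nonneg hx0
  have h5 := mul_le_mul (hs.J_le hp ht) hx.le_tmax hx0 (hs.J_nonneg.trans (hs.J_le hp ht))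
  unfold cost
  rw [abs_le]
  constructor <;> nlinarith

theorem gammaNext_mem (hp : p.Admissible) (ht : p.tmin ≤ p.tmax) (s : State n) (x : Vec n) :
    gammaNext p s x ∈ Set.Icc p.γmin p.γmax :=
  proj_mem (hp.γmin_le_γmax ht) _

theorem gammaNext_le (hs : Reachable p s) (hp : p.Admissible) (ht : p.tmin ≤ p.tmax)
    (hc : p.v ≤ cost p s x) :
    gammaNext p s x ≤ max p.γmin (s.γ - 1 / (p.γmax * p.α * p.v)) := by
  refine (proj_le_max _ _ _).trans (max_le_max le_rfl ?_)
  have hγ := hs.γ_pos hp ht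
  have hv := hp.v_pos
  have hα := hp.α_pos
  have hγm := hp.γmax_pos
  have h1 : 1 / (p.γmax * p.α * p.v) ≤ cost p s x / (s.γ * p.α * p.v ^ 2) := by
    have h2 : 1 / (p.γmax * p.α * p.v) = p.v / (p.γmax * p.α * p.v ^ 2) := by field_simp
    rw [h2]
    have := hs.γ_mem.2
    have hc0 := hv.le.trans hc
    gcongr
  rw [neg_div]
  linarith

theorem initState (hp : p.Admissible) (ht : p.tmin ≤ p.tmax) : Reachable p (initState p) where
  Q_nonneg _ := le_rfl
  Q_le i := mul_nonneg (hp.q_nonneg i) hp.v_pos.le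
  γ_mem := ⟨le_rfl, hp.γmin_le_γmax ht⟩
  J_nonneg := le_rfl
  J_climb := Or.inl (mul_nonneg hp.v_pos.le hp.β₁_nonneg)

theorem step (hs : Reachable p s) (hp : p.Admissible) (ht : p.tmin ≤ p.tmax) {a : TaskMatrix n}
    (hx : p.Bounded (selectRow p s a)) : Reachable p (step p s a) := by
  set x := selectRow p s a with hxdef
  have hmem := gammaNext_mem hp ht s x
  have hinv := hp.one_div_mem ht hmem
  have hη : 0 < p.γmax * p.α * p.v := mul_pos (mul_pos hp.γmax_pos hp.α_pos) hp.v_pos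
  have hδ : 0 ≤ p.tmax - p.tmin := sub_nonneg.2 ht
  have hβ : 0 ≤ p.v * p.β₁ := mul_nonneg hp.v_pos.le hp.β₁_nonneg
  have hJ : (Renewal.step p s a).J = max 0 (s.J + x.1 - 1 / gammaNext p s x) := rfl
  have hJle : (Renewal.step p s a).J ≤ s.J + (p.tmax - p.tmin) := by
    rw [hJ]
    exact max_le (add_nonneg hs.J_nonneg hδ) (by linarith [hx.le_tmax, hinv.1])
  refine ⟨fun i => (proj_mem (mul_nonneg (hp.q_nonneg i) hp.v_pos.le) _).1,
    fun i => (proj_mem (mul_nonneg (hp.q_nonneg i) hp.v_pos.le) _).2, hmem, le_max_left _ _, ?_⟩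
  change _ ∨ ∃ j : ℕ, 1 ≤ j ∧ (j : ℤ) ≤ p.climb ∧ _ ∧ gammaNext p s x ≤ _
  by_cases hlow : s.J ≤ p.v * p.β₁
  · by_cases hN : 1 ≤ p.climb
    · refine Or.inr ⟨1, le_rfl, by exact_mod_cast hN, by push_cast; linarith, ?_⟩
      refine hmem.2.trans (le_max_of_le_right ?_)
      simp
    -- Here `climb` ≤ 0, which forces t_max = t_min, so J cannot grow at all.
    · left
      have h0 : p.α * p.v * p.γmax * (p.γmax - p.γmin) ≤ 0 := by
        have : p.climb ≤ 0 := by omega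
        exact_mod_cast Int.ceil_le.1 this
      have h1 : p.γmax - p.γmin ≤ 0 :=
        nonpos_of_mul_nonpos_right h0 (mul_pos (mul_pos hp.α_pos hp.v_pos) hp.γmax_pos)
      have h2 : p.tmax ≤ p.tmin :=
        (one_div_le_one_div hp.tmin_pos (hp.tmax_pos ht)).1 (sub_nonpos.1 h1)
      linarith
  · rcases hs.J_climb with h | ⟨j, hj1, hjN, hjJ, hjγ⟩
    · exact absurd h hlow
    · have hg := hs.gammaNext_le hp ht (hs.le_cost hp hx (not_le.1 hlow).le)
      have hg' : gammaNext p s x ≤ max p.γmin (p.γmax - j / (p.γmax * p.α * p.v)) := by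
        refine hg.trans (max_le (le_max_left _ _) ?_)
        have hpos : 0 < 1 / (p.γmax * p.α * p.v) := one_div_pos.2 hη
        rcases le_max_iff.1 hjγ with h | h
        · exact le_max_of_le_left (by linarith)
        · refine le_max_of_le_right ?_
          have : (j : ℝ) / (p.γmax * p.α * p.v)
              = (j - 1) / (p.γmax * p.α * p.v) + 1 / (p.γmax * p.α * p.v) := by ring
          linarith
      right
      by_cases hlt : (j : ℤ) + 1 ≤ p.climb
      · refine ⟨j + 1, by omega, by exact_mod_cast hlt, by push_cast; linarith, ?_⟩
        simpa using hg'
      -- After `climb` decrements γ has reached γ_min, so 1/γ = t_max ≥ T, J does not increase, and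
      -- the same j serves again.
      · have hjeq : (j : ℤ) = p.climb := by omega
        have hjr : p.α * p.v * p.γmax * (p.γmax - p.γmin) ≤ j := by
          have h1 := Int.le_ceil (p.α * p.v * p.γmax * (p.γmax - p.γmin))
          have h2 : (j : ℝ) = p.climb := by exact_mod_cast hjeq
          rw [h2]
          exact h1
        have h3 : p.γmax - p.γmin ≤ j / (p.γmax * p.α * p.v) := by
          rw [le_div_iff₀ hη]
          linarith
        have hgmin : gammaNext p s x = p.γmin := by
          refine le_antisymm (hg'.trans (max_le le_rfl ?_)) hmem.1
          linarith
        refine ⟨j, hj1, hjN, ?_, ?_⟩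
        · refine le_trans ?_ hjJ
          rw [hJ, hgmin, Params.γmin, one_div_one_div]
          exact max_le hs.J_nonneg (by linarith [hx.le_tmax])
        · rw [hgmin]
          exact le_max_left _ _

end Reachable

theorem selectRow_mem (p : Params n) (s : State n) (a : TaskMatrix n) :
    selectRow p s a ∈ rowSet a :=
  ⟨_, rfl⟩

theorem cost_selectRow_le (p : Params n) (s : State n) {a : TaskMatrix n} {x : Vec n}
    (hx : x ∈ rowSet a) : cost p s (selectRow p s a) ≤ cost p s x := by
  obtain ⟨r, rfl⟩ := hx
  exact (mem_minimizers p).1 (Finset.min'_mem _ (minimizers_nonempty p s a)) r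

theorem reachable_state (hp : p.Admissible) (ht : p.tmin ≤ p.tmax) {a : ℕ → TaskMatrix n}
    (ha : ∀ k, ∀ x ∈ rowSet (a k), p.Bounded x) (k : ℕ) : Reachable p (state p a k) := by
  induction k with
  | zero => exact Reachable.initState hp ht
  | succ k ih => exact ih.step hp ht (ha k _ (selectRow_mem p _ _))

/-- The Lyapunov function. -/
noncomputable def lyapunov (s : State n) : ℝ := (∑ i, s.Q i ^ 2 + s.J ^ 2) / 2

/-- The optimality inequality of `gammaNext`, by strong convexity. -/
theorem gammaNext_optimality (hp : p.Admissible) {s : State n} (x : Vec n) (hs : 0 < s.γ) {g : ℝ}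
    (hg : g ∈ Set.Icc p.γmin p.γmax) :
    gammaNext p s x / s.γ * cost p s x + p.α * p.v ^ 2 / 2 * (gammaNext p s x - s.γ) ^ 2
      ≤ g / s.γ * cost p s x
        + p.α * p.v ^ 2 / 2 * ((g - s.γ) ^ 2 - (g - gammaNext p s x) ^ 2) := by
  have hv := hp.v_pos
  have hα := hp.α_pos
  have hw : 0 < p.α * p.v ^ 2 := by positivity
  have key := proj_variational hg (s.γ + (-cost p s x) / (s.γ * p.α * p.v ^ 2))
  change 0 ≤ (g - gammaNext p s x) * (gammaNext p s x - _) at key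
  set h := gammaNext p s x
  -- Dividing by `s.γ` cancels the factor γ[k-1] in the proximal weight, so the squares telescope
  -- over tasks.
  obtain ⟨u, hu⟩ : ∃ u, u = cost p s x / s.γ := ⟨_, rfl⟩
  have e1 : (-cost p s x) / (s.γ * p.α * p.v ^ 2) = -u / (p.α * p.v ^ 2) := by
    rw [hu]
    field_simp
  have e2 : h / s.γ * cost p s x = h * u := by rw [hu]; ring
  have e3 : g / s.γ * cost p s x = g * u := by rw [hu]; ring
  rw [e1] at key
  have key2 : 0 ≤ p.α * p.v ^ 2 * ((g - h) * (h - (s.γ + -u / (p.α * p.v ^ 2)))) :=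
    mul_nonneg hw.le key
  have e4 : p.α * p.v ^ 2 * ((g - h) * (h - (s.γ + -u / (p.α * p.v ^ 2))))
      = p.α * p.v ^ 2 * ((g - h) * (h - s.γ)) + (g - h) * u := by
    field_simp
    ring
  rw [e2, e3]
  -- Uses 2(g - h)(h - γ) = (g - γ)² - (g - h)² - (h - γ)², with γ standing for `s.γ`.
  nlinarith

/-- The drift-plus-penalty inequality for one task. -/
theorem drift_le (hp : p.Admissible) (ht : p.tmin ≤ p.tmax) {s : State n} (hs : Reachable p s)
    {a : TaskMatrix n} (hx : p.Bounded (selectRow p s a)) {t r φ : ℝ}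
    (htr : t ∈ Set.Icc p.tmin p.tmax) (hφ : φ ≤ -p.v * r + s.J * t) :
    lyapunov (step p s a) - lyapunov s - p.v * (selectRow p s a).2.1
      ≤ p.d₁ * p.tmin + 1 / t * ((cost p s (selectRow p s a) - φ) / s.γ)
        - p.v * (r / t) * (1 / s.γ)
        + p.α * p.v ^ 2 / 2 * ((1 / t - s.γ) ^ 2 - (1 / t - (step p s a).γ) ^ 2) := by
  have hv := hp.v_pos
  have hα := hp.α_pos
  have hsγ := hs.γ_pos hp ht
  have ht0 : 0 < t := hp.tmin_pos.trans_le htr.1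
  have hγm := hp.γmin_pos ht
  have hopt := gammaNext_optimality hp (selectRow p s a) hsγ (hp.one_div_mem' htr)
  have hmem := Reachable.gammaNext_mem hp ht s (selectRow p s a)
  have hinv := hp.one_div_mem ht hmem
  have hγ' : (step p s a).γ = gammaNext p s (selectRow p s a) := rfl
  have hJ' : (step p s a).J
      = max 0 (s.J + ((selectRow p s a).1 - 1 / gammaNext p s (selectRow p s a))) := by
    rw [← add_sub_assoc]; rfl
  have hQ' : ∀ i, (step p s a).Q i = proj 0 (p.q i * p.v) (s.Q i + (selectRow p s a).2.2 i) :=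
    fun i => rfl
  rw [hγ']
  set x := selectRow p s a
  set g := gammaNext p s x
  have hg0 : 0 < g := hγm.trans_le hmem.1
  set Y := ∑ i, s.Q i * x.2.2 i with hY
  set τ := x.1 - 1 / g with hτ
  have hτb : |τ| ≤ p.tmax - p.tmin := by
    rw [abs_le]
    constructor <;> linarith [hx.tmin_le, hx.le_tmax, hinv.1, hinv.2]
  have hlyap : lyapunov (step p s a) ≤ lyapunov s + p.b + Y + s.J * τ := by
    have h1 : ∑ i, (step p s a).Q i ^ 2 ≤ ∑ i, s.Q i ^ 2 + 2 * Y + p.c ^ 2 := by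
      have hy : ∑ i, x.2.2 i ^ 2 ≤ p.c ^ 2 := by
        have := pow_le_pow_left₀ (norm_nonneg _) hx.norm_le 2
        simpa [EuclideanSpace.norm_sq_eq] using this
      calc ∑ i, (step p s a).Q i ^ 2 ≤ ∑ i, (s.Q i + x.2.2 i) ^ 2 :=
            Finset.sum_le_sum fun i _ => by
              rw [hQ']
              exact proj_zero_sq_le _ _
        _ = ∑ i, s.Q i ^ 2 + 2 * Y + ∑ i, x.2.2 i ^ 2 := by
            rw [hY, Finset.mul_sum, ← Finset.sum_add_distrib, ← Finset.sum_add_distrib]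
            exact Finset.sum_congr rfl fun i _ => by ring
        _ ≤ _ := by linarith
    have h2 : (step p s a).J ^ 2 ≤ s.J ^ 2 + 2 * (s.J * τ) + (p.tmax - p.tmin) ^ 2 := by
      have h3 : τ ^ 2 ≤ (p.tmax - p.tmin) ^ 2 := by
        rw [← sq_abs]
        exact pow_le_pow_left₀ (abs_nonneg _) hτb 2
      have h4 := max_zero_sq_le (s.J + τ)
      rw [hJ']
      linarith
    unfold lyapunov Params.b
    linarith
  -- Z is the part of the drift-plus-penalty bound that the algorithm controls; up to J/γ[k] it is
  -- the minimized cost.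
  obtain ⟨Z, hZ⟩ : ∃ Z, Z = -p.v * x.2.1 + Y + s.J * τ := ⟨_, rfl⟩
  have hcost : cost p s x = Z + s.J / g := by
    rw [hZ, hτ, hY]
    unfold cost
    ring
  set K := p.rmax + p.c * ‖p.q‖ + (p.tmax - p.tmin) * (p.β₁ + p.β₂) with hK
  have hZb : |Z| ≤ p.v * K := by
    have h1 := abs_le.1 (hs.abs_sum_le hp hx)
    rw [← hY] at h1
    have h2 := mul_le_mul_of_nonneg_left hx.reward_le hv.le
    have h3 := mul_nonneg hv.le hx.reward_nonneg
    have h4 : |s.J * τ| ≤ p.v * (p.β₁ + p.β₂) * (p.tmax - p.tmin) := by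
      rw [abs_mul, abs_of_nonneg hs.J_nonneg]
      exact mul_le_mul (hs.J_le hp ht) hτb (abs_nonneg _)
        (hs.J_nonneg.trans (hs.J_le hp ht))
    have h5 := abs_le.1 h4
    rw [hZ, abs_le, hK]
    constructor <;> nlinarith
  -- Completing the square: the proximal term pays for the change of γ, and what remains is the
  -- second summand of d₁ t_min.
  have hyoung : -((g - s.γ) * (Z / s.γ)) ≤ p.α * p.v ^ 2 / 2 * (g - s.γ) ^ 2
      + 1 / (2 * p.γmin ^ 2 * p.α) * K ^ 2 := by
    have h1 : (Z / s.γ) ^ 2 ≤ p.v ^ 2 * (K ^ 2 / p.γmin ^ 2) := by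
      have h2 : |Z / s.γ| ≤ p.v * K / p.γmin := by
        rw [abs_div, abs_of_pos hsγ]
        exact div_le_div₀ ((abs_nonneg _).trans hZb) hZb hγm hs.γ_mem.1
      rw [← sq_abs]
      refine (pow_le_pow_left₀ (abs_nonneg _) h2 2).trans (le_of_eq ?_)
      ring
    have h3 : 1 / (2 * p.γmin ^ 2 * p.α) * K ^ 2
        = 1 / (2 * p.α * p.v ^ 2) * (p.v ^ 2 * (K ^ 2 / p.γmin ^ 2)) := by field_simp
    have h4 : 1 / (2 * p.α * p.v ^ 2) * (Z / s.γ) ^ 2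
        ≤ 1 / (2 * p.α * p.v ^ 2) * (p.v ^ 2 * (K ^ 2 / p.γmin ^ 2)) :=
      mul_le_mul_of_nonneg_left h1 (by positivity)
    have h5 : 0 ≤ 1 / (2 * p.α * p.v ^ 2) * (p.α * p.v ^ 2 * (g - s.γ) + Z / s.γ) ^ 2 := by
      positivity
    have h6 : 1 / (2 * p.α * p.v ^ 2) * (p.α * p.v ^ 2 * (g - s.γ) + Z / s.γ) ^ 2
        = p.α * p.v ^ 2 / 2 * (g - s.γ) ^ 2 + (g - s.γ) * (Z / s.γ)
          + 1 / (2 * p.α * p.v ^ 2) * (Z / s.γ) ^ 2 := by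
      generalize Z / s.γ = u
      field_simp
      ring
    linarith
  have hd : p.d₁ * p.tmin = p.b + 1 / (2 * p.γmin ^ 2 * p.α) * K ^ 2 := by
    have := hp.tmin_pos.ne'
    unfold Params.d₁
    rw [div_mul_cancel₀ _ this]
  -- The factor 1/t turns J t into J, so this J/γ[k-1] cancels the one in `e1`.
  have hφ' : 1 / t / s.γ * φ ≤ -(p.v * (r / t) * (1 / s.γ)) + s.J / s.γ := by
    refine (mul_le_mul_of_nonneg_left hφ (by positivity)).trans (le_of_eq ?_)
    field_simp
  have e1 : g / s.γ * cost p s x = Z + (g - s.γ) * (Z / s.γ) + s.J / s.γ := by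
    rw [hcost]
    field_simp
    ring
  have e2 : 1 / t / s.γ * cost p s x
      = 1 / t * ((cost p s x - φ) / s.γ) + 1 / t / s.γ * φ := by ring
  rw [hd]
  rw [e1, e2] at hopt
  linarith

end Renewal

/-! ### Conditional mean costs, deviations and the bound for finitely many tasks -/

namespace Renewal

variable {n : ℕ}

/-- The cost as a continuous linear functional. -/
noncomputable def costCLM (p : Params n) (s : State n) : Vec n →L[ℝ] ℝ :=
  (-p.v) • (ContinuousLinearMap.fst ℝ ℝ (EuclideanSpace ℝ (Fin n))).comp
      (ContinuousLinearMap.snd ℝ ℝ (ℝ × EuclideanSpace ℝ (Fin n)))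
    + s.J • ContinuousLinearMap.fst ℝ ℝ (ℝ × EuclideanSpace ℝ (Fin n))
    + ∑ i, s.Q i • (EuclideanSpace.proj i).comp
      ((ContinuousLinearMap.snd ℝ ℝ (EuclideanSpace ℝ (Fin n))).comp
        (ContinuousLinearMap.snd ℝ ℝ (ℝ × EuclideanSpace ℝ (Fin n))))

theorem costCLM_apply (p : Params n) (s : State n) (x : Vec n) : costCLM p s x = cost p s x := by
  simp [costCLM, cost]

theorem continuous_cost (p : Params n) (s : State n) : Continuous (cost p s) :=
  (costCLM p s).continuous.congr (costCLM_apply p s)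

variable {p : Params n}

theorem Params.Bounded.norm_le_add {x : Vec n} (hp : p.Admissible) (hx : p.Bounded x) :
    ‖x‖ ≤ p.tmax + p.rmax + p.c := by
  have h1 : |x.1| ≤ p.tmax := abs_le.2
    ⟨by linarith [hx.tmin_le, hp.tmin_pos, hp.tmax_nonneg], hx.le_tmax⟩
  have h2 : |x.2.1| ≤ p.rmax := abs_le.2
    ⟨by linarith [hx.reward_nonneg, hp.rmax_nonneg], hx.reward_le⟩
  have h3 := hx.norm_le
  have h4 := hp.tmax_nonneg
  have h5 := hp.rmax_nonneg
  have h6 := hp.c_nonneg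
  rw [Prod.norm_def, Prod.norm_def, Real.norm_eq_abs, Real.norm_eq_abs]
  exact max_le (by linarith) (max_le (by linarith) (by linarith))

variable {Ω : Type*} [MeasurableSpace Ω] {μ : Measure Ω} [IsProbabilityMeasure μ]

section Decision

variable {D : Ω → Vec n}

theorem integrable_of_bounded (hp : p.Admissible) (hD : Measurable D)
    (hDb : ∀ ω, p.Bounded (D ω)) : Integrable D μ :=
  Integrable.of_bound hD.aestronglyMeasurable _
    (ae_of_all _ fun ω => Params.Bounded.norm_le_add hp (hDb ω))

theorem integrable_cost (hp : p.Admissible) (hD : Measurable D) (hDb : ∀ ω, p.Bounded (D ω))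
    (s : State n) : Integrable (fun ω => cost p s (D ω)) μ := by
  simp_rw [← costCLM_apply]
  exact (costCLM p s).integrable_comp (integrable_of_bounded hp hD hDb)

theorem integral_cost (hp : p.Admissible) (hD : Measurable D) (hDb : ∀ ω, p.Bounded (D ω))
    (s : State n) : ∫ ω, cost p s (D ω) ∂μ = cost p s (∫ ω, D ω ∂μ) := by
  simp_rw [← costCLM_apply]
  exact (costCLM p s).integral_comp_comm (integrable_of_bounded hp hD hDb)

end Decision

/-- The expected cost of the selected row in state `s`. -/
noncomputable def meanCost (p : Params n) (μ : Measure Ω) (A : Ω → TaskMatrix n) (s : State n) :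
    ℝ :=
  ∫ ω, cost p s (selectRow p s (A ω)) ∂μ

/-- The normalized deviation of the cost of the selected row from its expectation. -/
noncomputable def deviation (p : Params n) (μ : Measure Ω) (A : Ω → TaskMatrix n) (s : State n)
    (a : TaskMatrix n) : ℝ :=
  (cost p s (selectRow p s a) - meanCost p μ A s) / s.γ

theorem measurable_selectRow_right (p : Params n) (s : State n) : Measurable (selectRow p s) :=
  (measurable_selectRow p).comp measurable_prodMk_left

theorem measurable_cost_selectRow (p : Params n) :
    Measurable fun z : State n × TaskMatrix n => cost p z.1 (selectRow p z.1 z.2) :=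
  (measurable_cost p).comp (measurable_fst.prodMk (measurable_selectRow p))

theorem measurable_meanCost (p : Params n) {A : Ω → TaskMatrix n} (hA : Measurable A) :
    Measurable (meanCost p μ A) := by
  have h : Measurable fun z : State n × Ω => cost p z.1 (selectRow p z.1 (A z.2)) :=
    (measurable_cost_selectRow p).comp (measurable_fst.prodMk (hA.comp measurable_snd))
  exact h.stronglyMeasurable.integral_prod_right'.measurable

theorem measurable_deviation (p : Params n) {A : Ω → TaskMatrix n} (hA : Measurable A) :
    Measurable fun z : State n × TaskMatrix n => deviation p μ A z.1 z.2 :=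
  ((measurable_cost_selectRow p).sub ((measurable_meanCost p hA).comp measurable_fst)).div
    (State.measurable_γ.comp measurable_fst)

section Closure

variable {A : Ω → TaskMatrix n}

/-- The selected row beats any decision vector pointwise, and a linear cost commutes with
expectation. The inequality is closed in x, so it passes to the closure. -/
theorem meanCost_le (hp : p.Admissible) (hA : Measurable A)
    (hb : ∀ ω, ∀ x ∈ rowSet (A ω), p.Bounded x) (s : State n) {x : Vec n}
    (hx : x ∈ closure (Gamma μ A)) : meanCost p μ A s ≤ cost p s x := by
  refine closure_minimal (t := {x | meanCost p μ A s ≤ cost p s x}) ?_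
    (isClosed_le continuous_const (continuous_cost p s)) hx
  rintro x ⟨D, hD, hDA, rfl⟩
  have hDb : ∀ ω, p.Bounded (D ω) := fun ω => hb ω _ (hDA ω)
  rw [Set.mem_ofPred_eq, ← integral_cost hp hD hDb]
  exact integral_mono
    (integrable_cost hp ((measurable_selectRow_right p s).comp hA)
      (fun ω => hb ω _ (selectRow_mem p s _)) s)
    (integrable_cost hp hD hDb s) fun ω => cost_selectRow_le p s (hDA ω)

/-- These constraints define a closed convex set, which contains the expectation of any random
vector with values in it. -/
theorem mem_of_mem_closure_Gamma (hp : p.Admissible)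
    (hb : ∀ ω, ∀ x ∈ rowSet (A ω), p.Bounded x) {x : Vec n} (hx : x ∈ closure (Gamma μ A)) :
    x.1 ∈ Set.Icc p.tmin p.tmax ∧ 0 ≤ x.2.1 := by
  let S : Set (Vec n) := Set.Icc p.tmin p.tmax ×ˢ (Set.Ici 0 ×ˢ Set.univ)
  have hSc : IsClosed S := isClosed_Icc.prod (isClosed_Ici.prod isClosed_univ)
  have hS : Convex ℝ S := (convex_Icc _ _).prod ((convex_Ici _).prod convex_univ)
  have hmem : x ∈ S := by
    refine closure_minimal ?_ hSc hx
    rintro x ⟨D, hD, hDA, rfl⟩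
    have hDb : ∀ ω, p.Bounded (D ω) := fun ω => hb ω _ (hDA ω)
    exact hS.integral_mem hSc
      (ae_of_all _ fun ω => ⟨⟨(hDb ω).tmin_le, (hDb ω).le_tmax⟩, (hDb ω).reward_nonneg, trivial⟩)
      (integrable_of_bounded hp hD hDb)
  exact ⟨hmem.1, hmem.2.1⟩

theorem abs_deviation_le (hp : p.Admissible) (ht : p.tmin ≤ p.tmax)
    (hb : ∀ ω, ∀ x ∈ rowSet (A ω), p.Bounded x) {s : State n} (hs : Reachable p s)
    {a : TaskMatrix n} (ha : ∀ x ∈ rowSet a, p.Bounded x) :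
    |deviation p μ A s a| ≤
      2 * (p.v * (p.rmax + (p.β₁ + p.β₂) * p.tmax + p.c * ‖p.q‖)) / p.γmin := by
  have h1 := hs.abs_cost_le hp ht (ha _ (selectRow_mem p s a))
  have h2 : |meanCost p μ A s| ≤ p.v * (p.rmax + (p.β₁ + p.β₂) * p.tmax + p.c * ‖p.q‖) := by
    have := norm_integral_le_of_norm_le_const (μ := μ)
      (f := fun ω => cost p s (selectRow p s (A ω)))
      (ae_of_all _ fun ω => hs.abs_cost_le hp ht (hb ω _ (selectRow_mem p s (A ω))))
    simpa [meanCost] using this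
  have h3 := abs_sub (cost p s (selectRow p s a)) (meanCost p μ A s)
  unfold deviation
  rw [abs_div, abs_of_pos (hs.γ_pos hp ht)]
  exact div_le_div₀ (by linarith [(abs_nonneg _).trans h1]) (by linarith) (hp.γmin_pos ht)
    hs.γ_mem.1

end Closure

theorem integral_deviation (hp : p.Admissible) {A₀ A₁ : Ω → TaskMatrix n}
    (hid : IdentDistrib A₁ A₀ μ μ) (hA₀ : Measurable A₀)
    (hb : ∀ ω, ∀ x ∈ rowSet (A₀ ω), p.Bounded x) (s : State n) :
    ∫ a, deviation p μ A₀ s a ∂(μ.map A₁) = 0 := by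
  have hint : Integrable (fun ω => cost p s (selectRow p s (A₀ ω))) μ :=
    integrable_cost hp ((measurable_selectRow_right p s).comp hA₀)
      (fun ω => hb ω _ (selectRow_mem p s _)) s
  have hm : Measurable (deviation p μ A₀ s) :=
    (measurable_deviation p hA₀).comp measurable_prodMk_left
  rw [hid.map_eq, integral_map hA₀.aemeasurable hm.aestronglyMeasurable]
  unfold deviation
  rw [integral_div, integral_sub hint (integrable_const _)]
  simp [meanCost]

section Sequence

variable {A : ℕ → Ω → TaskMatrix n} {U : Ω → ℝ}

theorem measurable_deviation_state (p : Params n) (hA : ∀ k, Measurable (A k)) (k : ℕ) :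
    Measurable fun ω => deviation p μ (A 0) (state p (fun i => A i ω) k) (A k ω) := by
  have h1 : Measurable fun ω i => A i ω := measurable_pi_lambda _ hA
  have h2 : Measurable fun ω => state p (fun i => A i ω) k := (measurable_state p k).comp h1
  have h3 := (measurable_deviation (μ := μ) p (hA 0)).fun_comp (h2.prodMk (hA k))
  exact h3

/-- Martingale-difference orthogonality. With the first k matrices fixed, the earlier deviation and
the state at time k are constants, and the later deviation integrates to 0 over the independent
matrix `A k`; Fubini concludes. -/
theorem integral_deviation_mul_deviation (hp : p.Admissible) (ht : p.tmin ≤ p.tmax)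
    (hA : StochasticAssumptions μ p A U) {j k : ℕ} (hjk : j < k) :
    ∫ ω, deviation p μ (A 0) (state p (fun i => A i ω) j) (A j ω)
      * deviation p μ (A 0) (state p (fun i => A i ω) k) (A k ω) ∂μ = 0 := by
  let H : Ω → Finset.range k → TaskMatrix n := fun ω i => A i ω
  have hH : Measurable H := measurable_pi_lambda _ fun i => hA.measurable_A i
  have hind : IndepFun H (A k) μ := by
    have h := hA.indep.indepFun_finset (Finset.range k) {k} (by simp) hA.measurable_A
    exact h.comp (φ := id) (ψ := fun f : ({k} : Finset ℕ) → TaskMatrix n =>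
      f ⟨k, Finset.mem_singleton_self k⟩) measurable_id (measurable_pi_apply _)
  have hdev := measurable_deviation (μ := μ) p (hA.measurable_A 0)
  let G : (Finset.range k → TaskMatrix n) × TaskMatrix n → ℝ := fun z =>
    deviation p μ (A 0) (state p (extendHistory k z.1) j) (extendHistory k z.1 j)
      * deviation p μ (A 0) (state p (extendHistory k z.1) k) z.2
  have hst : ∀ i, Measurable fun h : Finset.range k → TaskMatrix n =>
      state p (extendHistory k h) i := fun i =>
    (measurable_state p i).comp (measurable_extendHistory k)
  have hfst : Measurable fun z : (Finset.range k → TaskMatrix n) × TaskMatrix n => z.1 :=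
    measurable_fst
  have hsnd : Measurable fun z : (Finset.range k → TaskMatrix n) × TaskMatrix n => z.2 :=
    measurable_snd
  have hG : Measurable G := by
    refine Measurable.mul ?_ ?_
    · have h1 : Measurable fun h : Finset.range k → TaskMatrix n => extendHistory k h j :=
        (measurable_pi_apply j).comp (measurable_extendHistory k)
      have h2 := (hdev.fun_comp ((hst j).prodMk h1)).fun_comp hfst
      exact h2
    · have h3 := hdev.fun_comp (((hst k).fun_comp hfst).prodMk hsnd)
      exact h3
  have hGH : ∀ ω, G (H ω, A k ω) =
      deviation p μ (A 0) (state p (fun i => A i ω) j) (A j ω)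
        * deviation p μ (A 0) (state p (fun i => A i ω) k) (A k ω) := by
    intro ω
    have h1 := state_extendHistory p hjk.le fun i => A i ω
    have h2 := state_extendHistory p le_rfl (k := k) fun i => A i ω
    have h3 := extendHistory_apply hjk fun i => A i ω
    simp only [G, H, h1, h2, h3]
  have hpair : Measurable fun ω => (H ω, A k ω) := hH.prodMk (hA.measurable_A k)
  have hmap := (indepFun_iff_map_prod_eq_prod_map_map hH.aemeasurable
    (hA.measurable_A k).aemeasurable).1 hind
  -- The bound on G is only available on genuine histories, so integrability is checked after
  -- pulling back to Ω.
  have hint : Integrable G ((μ.map H).prod (μ.map (A k))) := by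
    rw [← hmap, integrable_map_measure hG.aestronglyMeasurable hpair.aemeasurable]
    obtain ⟨C, hbd⟩ : ∃ C, ∀ i ω,
        |deviation p μ (A 0) (state p (fun i => A i ω) i) (A i ω)| ≤ C :=
      ⟨_, fun i ω => abs_deviation_le hp ht (hA.bounded 0)
        (reachable_state hp ht (fun k => hA.bounded k ω) i) (hA.bounded i ω)⟩
    refine Integrable.of_bound (hG.comp hpair).aestronglyMeasurable (C * C)
      (ae_of_all _ fun ω => ?_)
    rw [Function.comp_apply, hGH, norm_mul]
    exact mul_le_mul (hbd j ω) (hbd k ω) (abs_nonneg _) ((abs_nonneg _).trans (hbd j ω))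
  have : IsProbabilityMeasure (μ.map H) := Measure.isProbabilityMeasure_map hH.aemeasurable
  have : IsProbabilityMeasure (μ.map (A k)) :=
    Measure.isProbabilityMeasure_map (hA.measurable_A k).aemeasurable
  simp_rw [← hGH]
  rw [← integral_map hpair.aemeasurable hG.aestronglyMeasurable, hmap, integral_prod _ hint]
  simp only [G, integral_const_mul,
    integral_deviation hp (hA.identDistrib k) (hA.measurable_A 0) (hA.bounded 0), mul_zero,
    integral_zero]

/-- The averages of the deviations vanish almost surely. -/
theorem ae_tendsto_avg_deviation (hp : p.Admissible) (ht : p.tmin ≤ p.tmax)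
    (hA : StochasticAssumptions μ p A U) :
    ∀ᵐ ω ∂μ, Tendsto (fun m : ℕ => (∑ k ∈ Finset.range m,
      deviation p μ (A 0) (state p (fun i => A i ω) k) (A k ω)) / m) atTop (nhds 0) :=
  ae_tendsto_avg_of_orthogonal (measurable_deviation_state p hA.measurable_A)
    (fun k ω => abs_deviation_le hp ht (hA.bounded 0)
      (reachable_state hp ht (fun k => hA.bounded k ω) k) (hA.bounded k ω))
    fun _ _ hjk => integral_deviation_mul_deviation hp ht hA hjk

end Sequence

/-- The performance bound for a finite number of tasks on a sample path.  Here `φ k` bounds the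
expected cost of task `k` given the past. -/
theorem sum_drift_le (hp : p.Admissible) (ht : p.tmin ≤ p.tmax) {a : ℕ → TaskMatrix n}
    (ha : ∀ k, ∀ x ∈ rowSet (a k), p.Bounded x) {t r : ℝ} (htr : t ∈ Set.Icc p.tmin p.tmax)
    (hr : 0 ≤ r) {φ : ℕ → ℝ} (hφ : ∀ k, φ k ≤ -p.v * r + (state p a k).J * t) (m : ℕ) :
    p.v * (r / t) * (∑ k ∈ Finset.range m, (decision p a k).1 - p.v * (p.β₁ + p.β₂))
        - p.v * ∑ k ∈ Finset.range m, (decision p a k).2.1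
      ≤ m * (p.d₁ * p.tmin) + 1 / t * ∑ k ∈ Finset.range m,
          (cost p (state p a k) (decision p a k) - φ k) / (state p a k).γ
        + p.α * p.v ^ 2 / 2 * (1 / t - p.γmin) ^ 2 := by
  have hre := reachable_state hp ht ha
  have hdec : ∀ k, p.Bounded (decision p a k) := fun k => ha k _ (selectRow_mem p _ _)
  have hv := hp.v_pos
  have hα := hp.α_pos
  have ht0 : 0 < t := hp.tmin_pos.trans_le htr.1
  -- The virtual queue `J` controls the total duration.
  have hJ : ∀ m, ∑ k ∈ Finset.range m, (decision p a k).1 + p.tmax - 1 / (state p a m).γ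
      ≤ ∑ k ∈ Finset.range m, 1 / (state p a k).γ + (state p a m).J := by
    intro m
    induction m with
    -- The state with index k stores γ[k-1], so the sum of 1/γ is shifted by one task; `p.tmax` =
    -- 1/γ[0] and the last 1/γ are the boundary terms.
    | zero => simp [state, initState, Params.γmin]
    | succ m ih =>
      have h1 : (state p a m).J + (decision p a m).1 - 1 / (state p a (m + 1)).γ
          ≤ (state p a (m + 1)).J := le_max_right _ _
      rw [Finset.sum_range_succ, Finset.sum_range_succ]
      linarith
  have hL : ∀ m, lyapunov (state p a m) - p.v * ∑ k ∈ Finset.range m, (decision p a k).2.1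
      ≤ m * (p.d₁ * p.tmin) + 1 / t * ∑ k ∈ Finset.range m,
          (cost p (state p a k) (decision p a k) - φ k) / (state p a k).γ
        - p.v * (r / t) * ∑ k ∈ Finset.range m, 1 / (state p a k).γ
        + p.α * p.v ^ 2 / 2 * ((1 / t - p.γmin) ^ 2 - (1 / t - (state p a m).γ) ^ 2) := by
    intro m
    induction m with
    | zero => simp [state, initState, lyapunov]
    | succ m ih =>
      have h1 := drift_le hp ht (hre m) (hdec m) htr (hφ m)
      rw [Finset.sum_range_succ, Finset.sum_range_succ, Finset.sum_range_succ]
      change lyapunov (state p a (m + 1)) - _ - _ * (decision p a m).2.1 ≤ _ + _ *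
        ((cost p (state p a m) (decision p a m) - _) / _)
          - _ + _ * (_ - (_ - (state p a (m + 1)).γ) ^ 2)
        at h1
      push_cast
      linarith
  have hL0 : 0 ≤ lyapunov (state p a m) :=
    div_nonneg (add_nonneg (Finset.sum_nonneg fun _ _ => sq_nonneg _) (sq_nonneg _)) two_pos.le
  have hsq : 0 ≤ p.α * p.v ^ 2 / 2 * (1 / t - (state p a m).γ) ^ 2 := by positivity
  have h1 : p.v * (r / t) * (∑ k ∈ Finset.range m, (decision p a k).1 - p.v * (p.β₁ + p.β₂))
      ≤ p.v * (r / t) * ∑ k ∈ Finset.range m, 1 / (state p a k).γ := by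
    refine mul_le_mul_of_nonneg_left ?_ (by positivity)
    have h3 := hJ m
    have h4 := (hre m).J_le hp ht
    have h5 := (hp.one_div_mem ht (hre m).γ_mem).2
    linarith
  have h2 := hL m
  linarith

end Renewal

/-! ### Passage to the limit on a sample path -/

namespace Renewal

variable {n : ℕ} {p : Params n}

theorem Params.Admissible.d₁_nonneg (hp : p.Admissible) : 0 ≤ p.d₁ := by
  have h1 := hp.α_pos
  have h2 := hp.tmin_pos
  unfold Params.d₁ Params.b
  positivity

/-- The performance bound on a sample path on which the averages of the deviations vanish. -/
theorem le_liminf_of_tendsto (hp : p.Admissible) (ht : p.tmin ≤ p.tmax) {a : ℕ → TaskMatrix n}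
    (ha : ∀ k, ∀ x ∈ rowSet (a k), p.Bounded x) {t r : ℝ} (htr : t ∈ Set.Icc p.tmin p.tmax)
    (hr : 0 ≤ r) {φ : ℕ → ℝ} (hφ : ∀ k, φ k ≤ -p.v * r + (state p a k).J * t)
    (hlim : Tendsto (fun m : ℕ => (∑ k ∈ Finset.range m,
      (cost p (state p a k) (decision p a k) - φ k) / (state p a k).γ) / m) atTop (nhds 0)) :
    ((r / t - p.d₁ / p.v : ℝ) : EReal) ≤
      liminf (fun m : ℕ => ((avgR p a m / avgT p a m : ℝ) : EReal)) atTop := by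
  have hv := hp.v_pos
  have htm := hp.tmin_pos
  let W : ℕ → ℝ := fun m => ∑ k ∈ Finset.range m,
    (cost p (state p a k) (decision p a k) - φ k) / (state p a k).γ
  -- The terms of `sum_drift_le` that do not depend on m: the bound on J and the initial proximal
  -- square.
  obtain ⟨c, hc⟩ : ∃ c, c = p.v * (r / t) * (p.v * (p.β₁ + p.β₂))
      + p.α * p.v ^ 2 / 2 * (1 / t - p.γmin) ^ 2 := ⟨_, rfl⟩
  have hc0 : 0 ≤ c := by
    have h1 := hp.β₁_nonneg
    have h2 := hp.β₂_nonneg ht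
    have h3 := hp.α_pos
    have h4 : 0 ≤ r / t := div_nonneg hr (htm.le.trans htr.1)
    rw [hc]
    positivity
  let e : ℕ → ℝ := fun m => (|1 / t * (W m / m)| + c / m) / p.v
  have he0 : ∀ m, 0 ≤ e m := fun m => by positivity
  have he : Tendsto e atTop (nhds 0) := by
    have h1 := (hlim.const_mul (1 / t)).abs
    have h2 := (h1.add (tendsto_const_div_atTop_nhds_zero_nat c)).div_const p.v
    rw [mul_zero, abs_zero, zero_add, zero_div] at h2
    exact h2
  have hlow : Tendsto (fun m => ((r / t - p.d₁ / p.v - e m / p.tmin : ℝ) : EReal)) atTop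
      (nhds ((r / t - p.d₁ / p.v : ℝ) : EReal)) := by
    refine EReal.tendsto_coe.2 ?_
    simpa using (he.div_const p.tmin).const_sub (r / t - p.d₁ / p.v)
  rw [← hlow.liminf_eq]
  refine liminf_le_liminf ?_
  filter_upwards [eventually_ge_atTop 1] with m hm
  rw [EReal.coe_le_coe_iff]
  have hm0 : (0 : ℝ) < m := by exact_mod_cast hm
  have hsum := sum_drift_le hp ht ha htr hr hφ m
  change _ ≤ _ + 1 / t * W m + _ at hsum
  have hTlow : m * p.tmin ≤ ∑ k ∈ Finset.range m, (decision p a k).1 := by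
    calc m * p.tmin = ∑ k ∈ Finset.range m, p.tmin := by simp
      _ ≤ _ := Finset.sum_le_sum fun k _ => (ha k _ (selectRow_mem p _ _)).tmin_le
  unfold avgR avgT
  rw [mul_div_mul_left _ _ (one_div_pos.2 hm0).ne']
  set T := ∑ k ∈ Finset.range m, (decision p a k).1
  set R := ∑ k ∈ Finset.range m, (decision p a k).2.1
  have hT0 : 0 < T := (mul_pos hm0 htm).trans_le hTlow
  rw [le_div_iff₀ hT0]
  -- A loss of d₁ t_min per task is at most a loss of d₁ per unit of time; this is why d₁ is divided
  -- by t_min.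
  have h1 : p.d₁ / p.v * (m * p.tmin) ≤ p.d₁ / p.v * T :=
    mul_le_mul_of_nonneg_left hTlow (div_nonneg hp.d₁_nonneg hv.le)
  have h2 : e m * m ≤ e m / p.tmin * T := by
    refine le_trans (le_of_eq ?_)
      (mul_le_mul_of_nonneg_left hTlow (div_nonneg (he0 m) htm.le))
    field_simp
  have h3 : 1 / t * W m + c ≤ p.v * (e m * m) := by
    have h4 : p.v * (e m * m) = |1 / t * (W m / m)| * m + c := by
      simp only [e]
      field_simp
    have h5 : 1 / t * W m = 1 / t * (W m / m) * m := by field_simp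
    rw [h4, h5]
    gcongr
    exact le_abs_self _
  have h6 : p.v * (p.d₁ / p.v * (m * p.tmin)) = m * (p.d₁ * p.tmin) := by field_simp
  have h7 : p.v * (r / t * T - p.d₁ / p.v * (m * p.tmin) - e m * m) ≤ p.v * R := by
    rw [hc] at h3
    linarith
  have h8 := le_of_mul_le_mul_left h7 hv
  linarith

end Renewal

theorem mainTheorem5 {n : ℕ} {Ω : Type*} [MeasurableSpace Ω] (μ : Measure Ω)
    [IsProbabilityMeasure μ] (p : Renewal.Params n) (hp : p.Admissible)
    (A : ℕ → Ω → Renewal.TaskMatrix n) (U : Ω → ℝ)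
    (hA : Renewal.StochasticAssumptions μ p A U)
    (tstar rstar : ℝ) (ystar : EuclideanSpace ℝ (Fin n))
    (hopt : Renewal.IsDetOptimal (Renewal.Gamma μ (A 0)) (tstar, rstar, ystar))
    (θstar : ℝ) (hθ : θstar = rstar / tstar) :
    ∀ᵐ ω ∂μ,
      ((θstar - p.d₁ / p.v : ℝ) : EReal) ≤
        liminf (fun m : ℕ =>
          ((Renewal.avgR p (fun k => A k ω) m / Renewal.avgT p (fun k => A k ω) m : ℝ) : EReal))
          atTop := by
  obtain ⟨⟨hcl, hy⟩, -⟩ := hopt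
  obtain ⟨ω₀⟩ : Nonempty Ω := nonempty_of_isProbabilityMeasure μ
  -- The order of the two bounds is read off any row at any sample point.
  have ht : p.tmin ≤ p.tmax := by
    have h := hA.bounded 0 ω₀ _ ⟨0, rfl⟩
    exact h.tmin_le.trans h.le_tmax
  obtain ⟨htr, hr⟩ := Renewal.mem_of_mem_closure_Gamma hp (hA.bounded 0) hcl
  filter_upwards [Renewal.ae_tendsto_avg_deviation hp ht hA] with ω hω
  have ha : ∀ k, ∀ x ∈ Renewal.rowSet (A k ω), p.Bounded x := fun k => hA.bounded k ω
  rw [hθ]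
  refine Renewal.le_liminf_of_tendsto hp ht ha htr hr
    (φ := fun k => Renewal.meanCost p μ (A 0) (Renewal.state p (fun i => A i ω) k))
    (fun k => ?_) hω
  refine (Renewal.meanCost_le hp (hA.measurable_A 0) (hA.bounded 0) _ hcl).trans ?_
  have hs := Renewal.reachable_state hp ht ha k
  have hQy : ∑ i, (Renewal.state p (fun i => A i ω) k).Q i * ystar i ≤ 0 :=
    Finset.sum_nonpos fun i _ => mul_nonpos_of_nonneg_of_nonpos (hs.Q_nonneg i) (hy i)
  unfold Renewal.cost
  linarith
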